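/- Let $\mathbb K$ be an algebraically closed field of characteristic zero, $\underline X=(X_1,\dots,X_d)$, and let $f(Y)\in\mathbb K[[\underline X]][Y]$ be a quasi-ordinary Weierstrass polynomial: $f$ is monic in $Y$, its other coefficients vanish at the origin, and its $Y$-discriminant equals $\underline X^{\alpha}u(\underline X)$ with $\alpha\in\mathbb N^d$ and $u(0)\neq 0$. Let $k\ge 1$ be an integer and let $\mathrm{Zer} f$ be the set of roots of $f$ in $\mathbb K[[X_1^{1/k},\dots,X_d^{1/k}]]$ (for suitable $k$ these are all the roots of $f$, by the Abhyankar--Jung theorem). For distinct $Y,Z\in\mathrm{Zer} f$ one has $Y-Z=\underline X^{\lambda}v$ with $\lambda\in\frac1k\mathbb N^d$ and $v(0)\neq 0$; the contact of $Y$ and $Z$ is $O(Y,Z)=\lambda$, and $O(Y,Y)=+\infty$. Contacts are compared in the componentwise order of $\mathbb Q^d$, with $+\infty$ on top. The bars of the tree model $T(f)$ are nonempty subsets of $\mathrm{Zer} f$. The lowest bar is $\mathrm{Zer} f$ (if it is nonempty). The height $h(B)$ of a bar $B$ is the least contact between elements of $B$. If $h(B)$ is finite, the postbars of $B$, which are again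 bars, are the classes of $B$ for the relation $O(Y,Z)>h(B)$. Bars of infinite height (single roots) are included; they have no postbars. Write $B\perp_c B'$ if $B'$ is a postbar of $B$ and $c\in\mathbb K$ is the (common) coefficient of $\underline X^{h(B)}$ in the elements of $B'$. For a bar $B$ let $\mathrm{Zer} f=B_0\perp_{c_0}B_1\perp_{c_1}\cdots\perp_{c_{r-1}}B_r=B$ be the sequence of bars that leads to $B$, and let the characteristic lattice of $B$ be $$N(B)=\mathbb Z^d+\sum_{0\le i<r,\ c_i\neq 0}\mathbb Z\,h(B_i)\subset\mathbb Q^d.$$ Let $U=\{\omega\in\mathbb K:\omega^k=1\}$. The group $U^d$ acts on $\mathbb K[[X_1^{1/k},\dots,X_d^{1/k}]]$ by $X_i^{1/k}\mapsto\epsilon_iX_i^{1/k}$, hence on the bars of $T(f)$; the conjugates of a bar $B$ are the bars $\underline\epsilon*B$, $\underline\epsilon\in U^d$ (including $B$). Then every bar $B$ of $T(f)$ has exactly $[N(B):\mathbb Z^d]$ conjugates. Moreover, let $B\perp_c B'$. 1. If $c\neq 0$, then exactly $[N(B)+\mathbb Z h(B):N(B)]$ postbars of $B$ (including $B'$) are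 conjugate to $B'$. 2. If $c=0$, then no postbar of $B$ other than $B'$ is conjugate to $B'$. -/

import Mathlib

namespace QuasiOrdinary

open MvPowerSeries

variable {K : Type*} [Field K] {d : ℕ}

/-- `f ∈ K[[X₁,…,X_d]][Y]` is a Weierstrass polynomial: it is monic in `Y` and its other
coefficients vanish at the origin. -/
def IsWeierstrass (f : Polynomial (MvPowerSeries (Fin d) K)) : Prop :=
  f.Monic ∧ ∀ i < f.natDegree, constantCoeff (f.coeff i) = 0

/-- `f` is quasi-ordinary: its `Y`-discriminant is a monomial times a unit. -/
def IsQuasiOrdinary (f : Polynomial (MvPowerSeries (Fin d) K)) : Prop :=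
  ∃ (a : Fin d →₀ ℕ) (u : MvPowerSeries (Fin d) K),
    constantCoeff u ≠ 0 ∧ f.discr = monomial a 1 * u

/-- The set `Zer f` of the roots of `f` in `K[[X₁^(1/k),…,X_d^(1/k)]]`. That ring is the power
series ring in the variables `Tᵢ = Xᵢ^(1/k)`, and `K[[X]]` embeds in it by `Xᵢ ↦ Tᵢ^k`. -/
def zer (k : ℕ) [NeZero k] (f : Polynomial (MvPowerSeries (Fin d) K)) :
    Set (MvPowerSeries (Fin d) K) :=
  {Y | f.eval₂ (expand k (NeZero.ne k) : MvPowerSeries (Fin d) K →ₐ[K] _).toRingHom Y = 0}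

/-- The exponent in `ℚ^d`, with respect to `X`, of the monomial `T^e`, where `Tᵢ = Xᵢ^(1/k)`. -/
def expo (k : ℕ) (e : Fin d →₀ ℕ) : Fin d → ℚ := fun i => (e i : ℚ) / k

/-- `HasContact k Y Z o` means `O(Y, Z) = o`: either `Y = Z` and `o = +∞`, or
`Y - Z = X^o * u` with `u(0) ≠ 0`. -/
def HasContact (k : ℕ) (Y Z : MvPowerSeries (Fin d) K) (o : WithTop (Fin d → ℚ)) : Prop :=
  (Y = Z ∧ o = ⊤) ∨
    ∃ (e : Fin d →₀ ℕ) (u : MvPowerSeries (Fin d) K),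
      constantCoeff u ≠ 0 ∧ Y - Z = monomial e 1 * u ∧ o = (expo k e : Fin d → ℚ)

/-- `HasHeight k B o` means `h(B) = o`: `o` is the least contact between elements of `B`, in the
componentwise order of `ℚ^d` with `+∞` added on top. -/
def HasHeight (k : ℕ) (B : Set (MvPowerSeries (Fin d) K)) (o : WithTop (Fin d → ℚ)) : Prop :=
  IsLeast {o' | ∃ Y ∈ B, ∃ Z ∈ B, HasContact k Y Z o'} o

/-- `Y ≡ Z mod h⁺`, that is `O(Y, Z) > h`. -/
def CongrMod (k : ℕ) (h : Fin d → ℚ) (Y Z : MvPowerSeries (Fin d) K) : Prop :=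
  ∃ o : WithTop (Fin d → ℚ), HasContact k Y Z o ∧ (h : WithTop (Fin d → ℚ)) < o

/-- `B ⊥ B'`: `B` has finite height and `B'` is one of the classes of `B` modulo `h(B)⁺`. -/
def Postbar (k : ℕ) (B B' : Set (MvPowerSeries (Fin d) K)) : Prop :=
  ∃ h : Fin d → ℚ, HasHeight k B h ∧ ∃ Y ∈ B, B' = {Z | Z ∈ B ∧ CongrMod k h Y Z}

/-- `B ⊥_c B'`: `B'` is a postbar of `B`, and `c` is the coefficient of `X^{h(B)}` in the elements
of `B'`. -/
def PostbarAt (k : ℕ) (B : Set (MvPowerSeries (Fin d) K)) (c : K)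
    (B' : Set (MvPowerSeries (Fin d) K)) : Prop :=
  Postbar k B B' ∧ ∃ e : Fin d →₀ ℕ, HasHeight k B (expo k e : Fin d → ℚ) ∧
    ∀ Y ∈ B', coeff e Y = c

/-- The bars of the tree model `T(f)`, those of infinite height included: everything that is
reached from the lowest bar `Zer f` by passing to postbars finitely often. -/
def bars (k : ℕ) [NeZero k] (f : Polynomial (MvPowerSeries (Fin d) K)) :
    Set (Set (MvPowerSeries (Fin d) K)) :=
  {B | (zer k f).Nonempty ∧ Relation.ReflTransGen (Postbar k) (zer k f) B}

/-- `H(B)`: the heights `h(A)` of the bars `A` on the way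
`Zer f ⊥ ⋯ ⊥ A ⊥_c A' ⊥ ⋯ ⊥ B` from the lowest bar to `B` for which `c ≠ 0`. -/
def heightSet (k : ℕ) [NeZero k] (f : Polynomial (MvPowerSeries (Fin d) K))
    (B : Set (MvPowerSeries (Fin d) K)) : Set (Fin d → ℚ) :=
  {h | ∃ A ∈ bars k f, ∃ (c : K) (A' : Set (MvPowerSeries (Fin d) K)),
    PostbarAt k A c A' ∧ c ≠ 0 ∧ Relation.ReflTransGen (Postbar k) A' B ∧ HasHeight k A h}

/-- The lattice `ℤ^d` in `ℚ^d`. -/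
def intLattice (d : ℕ) : AddSubgroup (Fin d → ℚ) :=
  ((Int.castAddHom ℚ).compLeft (Fin d)).range

/-- The characteristic lattice `N(B) = ℤ^d + ℤ h₁ + ⋯ + ℤ h_s`, where `H(B) = {h₁, …, h_s}`. -/
def charLattice (k : ℕ) [NeZero k] (f : Polynomial (MvPowerSeries (Fin d) K))
    (B : Set (MvPowerSeries (Fin d) K)) : AddSubgroup (Fin d → ℚ) :=
  intLattice d ⊔ AddSubgroup.closure (heightSet k f B)

/-- The action of `ε ∈ U^d`, where `U` is the group of `k`-th roots of unity of `K`, on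
`K[[X₁^(1/k),…,X_d^(1/k)]]`: it sends `Xᵢ^(1/k)` to `εᵢ * Xᵢ^(1/k)`. -/
noncomputable def starAct (k : ℕ) (ε : Fin d → rootsOfUnity k K) (Y : MvPowerSeries (Fin d) K) :
    MvPowerSeries (Fin d) K :=
  rescale (fun i => ((ε i : Kˣ) : K)) Y

/-- The conjugates `ε * B`, `ε ∈ U^d`, of `B` (among them `B` itself). -/
def conjugates (k : ℕ) (B : Set (MvPowerSeries (Fin d) K)) :
    Set (Set (MvPowerSeries (Fin d) K)) :=
  Set.range fun ε : Fin d → rootsOfUnity k K => starAct k ε '' B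

end QuasiOrdinary

/-! The number of conjugates of a bar is the index of its stabilizer in `U^d`. An element `ε`
multiplies the coefficient of `X^h` by a root of unity that depends only on the exponent `k h`
modulo `k`, and a postbar of `B` is the fibre over `c` of the coefficient of `X^{h(B)}` on `B`.
Hence `ε` fixes `B'` iff it fixes `B` and, when `c ≠ 0`, its character is trivial on `h(B)`
(`mem_stabilizer_postbar_iff`). By induction along the path, the stabilizer of `B` is the
annihilator of the subgroup of `(ℤ/k)^d` generated by the heights in `H(B)`. Duality of finite
abelian groups makes its index the order of that subgroup (`index_annihilator`), which is `[N(B) :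
ℤ^d]`.

The postbars of `B` conjugate to `B'` form the orbit of `B'` under the stabilizer of `B`, so their
number is a quotient of two such indices.

Contacts exist because a difference of roots divides the discriminant and the variables are prime.
-/

namespace QuasiOrdinary

open MvPowerSeries

/-! ### Power series that are a monomial times a unit -/

section Monomial

variable {K : Type*} [Field K] {σ : Type*}

/-- `D` is the monomial with exponent `e` times a unit. -/
def IsMonomialMulUnit (e : σ →₀ ℕ) (D : MvPowerSeries σ K) : Prop :=
  ∃ u : MvPowerSeries σ K, constantCoeff u ≠ 0 ∧ D = monomial e 1 * u

lemma IsMonomialMulUnit.coeff_ne_zero {e : σ →₀ ℕ} {D : MvPowerSeries σ K}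
    (h : IsMonomialMulUnit e D) : coeff e D ≠ 0 := by
  obtain ⟨u, hu, rfl⟩ := h
  simpa [coeff_monomial_mul] using hu

lemma IsMonomialMulUnit.le_of_coeff_ne_zero {e : σ →₀ ℕ} {D : MvPowerSeries σ K}
    (h : IsMonomialMulUnit e D) {m : σ →₀ ℕ} (hm : coeff m D ≠ 0) : e ≤ m := by
  obtain ⟨u, hu, rfl⟩ := h
  by_contra hle
  exact hm (by rw [coeff_monomial_mul, if_neg hle])

/-- Setting `X_s = 0` is a ring endomorphism of a domain, so its kernel is a prime ideal. -/
lemma X_dvd_iff_rescale_eq_zero [DecidableEq σ] (s : σ) (φ : MvPowerSeries σ K) :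
    X s ∣ φ ↔ rescale (Function.update (1 : σ → K) s 0) φ = 0 := by
  have key (m : σ →₀ ℕ) : (m.prod fun i n => Function.update (1 : σ → K) s 0 i ^ n) =
      if m s = 0 then 1 else 0 := by
    split_ifs with h
    · refine Finset.prod_eq_one fun i _ => ?_
      by_cases his : i = s
      · subst his; simp [h]
      · simp [his]
    · exact Finset.prod_eq_zero (Finsupp.mem_support_iff.2 h) (by simp [h])
  rw [X_dvd_iff, MvPowerSeries.ext_iff]
  refine forall_congr' fun m => ?_
  rw [coeff_rescale, key]
  by_cases h : m s = 0 <;> simp [h]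

lemma prime_X (s : σ) : Prime (X s : MvPowerSeries σ K) := by
  classical
  refine ⟨?_, ?_, fun a b h => ?_⟩
  · intro h
    have := congrArg (coeff (Finsupp.single s 1)) h
    simp [coeff_X] at this
  · intro h
    simpa using (isUnit_iff_constantCoeff.1 h).ne_zero
  · simp only [X_dvd_iff_rescale_eq_zero, map_mul, mul_eq_zero] at h ⊢
    exact h

/-- A divisor of a monomial times a unit is a monomial times a unit. -/
lemma IsMonomialMulUnit.of_mul [Finite σ] {e : σ →₀ ℕ} {a b : MvPowerSeries σ K}
    (h : IsMonomialMulUnit e (a * b)) : ∃ e', IsMonomialMulUnit e' a := by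
  classical
  have base {a b u : MvPowerSeries σ K} (hu : constantCoeff u ≠ 0) (h : a * b = u) :
      IsMonomialMulUnit 0 a := by
    refine ⟨a, fun h0 => hu ?_, by rw [monomial_zero_one, one_mul]⟩
    rw [← h, map_mul, h0, zero_mul]
  -- Cancel one variable of the monomial at a time: being prime, it divides `a` or `b`.
  induction hn : e.degree generalizing e a b with
  | zero =>
    obtain rfl : e = 0 := (Finsupp.degree_eq_zero_iff e).1 hn
    obtain ⟨u, hu, h⟩ := h
    exact ⟨0, base hu (h.trans (by rw [monomial_zero_one, one_mul]))⟩
  | succ n ih =>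
    obtain ⟨u, hu, h⟩ := h
    obtain ⟨s, hs⟩ : ∃ s, e s ≠ 0 := by
      by_contra! h0
      obtain rfl : e = 0 := Finsupp.ext h0
      simp at hn
    obtain ⟨e, rfl⟩ : ∃ e', e = Finsupp.single s 1 + e' :=
      ⟨e - Finsupp.single s 1, (add_tsub_cancel_of_le (by
        rw [Finsupp.single_le_iff]; lia)).symm⟩
    have hX : (monomial (Finsupp.single s 1 + e) (1 : K)) = X s * monomial e 1 := by
      rw [X, monomial_mul_monomial, one_mul]
    have hdeg : e.degree = n := by
      rw [map_add, Finsupp.degree_single] at hn; lia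
    rw [hX, mul_assoc] at h
    rcases (prime_X s).dvd_or_dvd ⟨_, h⟩ with ⟨a', rfl⟩ | ⟨b', rfl⟩
    · rw [mul_assoc] at h
      obtain ⟨e', v, hv, rfl⟩ := ih ⟨u, hu, mul_left_cancel₀ (prime_X s).ne_zero h⟩ hdeg
      exact ⟨Finsupp.single s 1 + e', v, hv, by
        rw [← mul_assoc, X, monomial_mul_monomial, one_mul]⟩
    · rw [mul_left_comm] at h
      exact ih ⟨u, hu, mul_left_cancel₀ (prime_X s).ne_zero h⟩ hdeg

end Monomial

/-- The difference of two distinct roots of a monic polynomial divides the discriminant. -/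
lemma sub_dvd_map_discr {R S : Type*} [CommRing R] [Nontrivial R] [CommRing S] [IsDomain S]
    (φ : R →+* S) {f : Polynomial R} (hf : f.Monic) {y z : S} (hy : f.eval₂ φ y = 0)
    (hz : f.eval₂ φ z = 0) (hyz : y ≠ z) : y - z ∣ φ f.discr := by
  open Polynomial in
  have hdeg : f.natDegree ≠ 0 := by
    intro h
    rw [hf.natDegree_eq_zero.1 h] at hy
    simp at hy
  have hres := resultant_deriv (natDegree_pos_iff_degree_pos.1 (Nat.pos_of_ne_zero hdeg))
  obtain ⟨p, q, -, -, hpq⟩ := exists_mul_add_mul_eq_C_resultant (m := f.natDegree)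
    (n := f.natDegree - 1) f f.derivative le_rfl (natDegree_derivative_le f) (Or.inl hdeg)
  -- With `f = (Y - y) g` one has `f'(y) = g(y)`, while `g(z) = 0` since `z ≠ y`.
  have hder : y - z ∣ f.derivative.eval₂ φ y := by
    rw [← eval_map] at hy hz
    rw [← eval_map, ← derivative_map]
    obtain ⟨g, hg⟩ := dvd_iff_isRoot.2 (show IsRoot (f.map φ) y from hy)
    rw [hg] at hz ⊢
    have hgz : g.eval z = 0 := by
      simpa [sub_eq_zero, hyz.symm] using hz
    simpa [hgz] using sub_dvd_eval_sub y z g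
  have hd : f.derivative.eval₂ φ y ∣ φ (f.resultant f.derivative f.natDegree (f.natDegree - 1)) := by
    refine ⟨q.eval₂ φ y, ?_⟩
    have := congrArg (eval₂ φ y) hpq
    rwa [eval₂_add, eval₂_mul, eval₂_mul, hy, zero_mul, zero_add, Polynomial.eval₂_C, eq_comm] at this
  have hd := hder.trans hd
  rw [hres, hf.leadingCoeff, mul_one, map_mul] at hd
  rcases neg_one_pow_eq_or R (f.natDegree * (f.natDegree - 1) / 2) with h | h <;>
    simpa [h] using hd

variable {K : Type*} [Field K] {d : ℕ}

lemma exists_hasContact (k : ℕ) [NeZero k] {f : Polynomial (MvPowerSeries (Fin d) K)}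
    (hf : f.Monic) (hQ : IsQuasiOrdinary f) {Y Z : MvPowerSeries (Fin d) K}
    (hY : Y ∈ zer k f) (hZ : Z ∈ zer k f) : ∃ o, HasContact k Y Z o := by
  by_cases hYZ : Y = Z
  · exact ⟨⊤, Or.inl ⟨hYZ, rfl⟩⟩
  obtain ⟨a, u, hu, hd⟩ := hQ
  have : IsDomain (MvPowerSeries (Fin d) K) := NoZeroDivisors.to_isDomain _
  obtain ⟨b, hb⟩ := sub_dvd_map_discr _ hf hY hZ hYZ
  have : IsMonomialMulUnit (k • a) ((Y - Z) * b) := by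
    refine ⟨expand k (NeZero.ne k) u, by rwa [constantCoeff_expand], ?_⟩
    rw [← hb, hd]
    simp [expand_monomial]
  obtain ⟨e, v, hv, h⟩ := this.of_mul
  exact ⟨_, Or.inr ⟨e, v, hv, h, rfl⟩⟩

/-- Any two elements of `B` have a contact. -/
def HasContacts (k : ℕ) (B : Set (MvPowerSeries (Fin d) K)) : Prop :=
  ∀ Y ∈ B, ∀ Z ∈ B, ∃ o, HasContact k Y Z o

lemma HasContacts.mono {k : ℕ} {A B : Set (MvPowerSeries (Fin d) K)} (hB : HasContacts k B)
    (h : A ⊆ B) : HasContacts k A :=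
  fun Y hY Z hZ => hB Y (h hY) Z (h hZ)

/-! ### Bars as fibres of a coefficient, and the tree they form -/

section Bars

variable {k : ℕ} {B B' : Set (MvPowerSeries (Fin d) K)}

lemma HasHeight.exists_expo {h : Fin d → ℚ} (hB : HasHeight k B h) :
    ∃ e : Fin d →₀ ℕ, h = expo k e ∧ ∃ Y ∈ B, ∃ Z ∈ B, coeff e Y ≠ coeff e Z := by
  obtain ⟨Y, hY, Z, hZ, ⟨-, ho⟩ | ⟨e, u, hu, he, ho⟩⟩ := hB.1
  · exact absurd ho WithTop.coe_ne_top
  · refine ⟨e, WithTop.coe_injective ho, Y, hY, Z, hZ, ?_⟩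
    rw [← sub_ne_zero, ← map_sub]
    exact IsMonomialMulUnit.coeff_ne_zero ⟨u, hu, he⟩

lemma Postbar.subset (h : Postbar k B B') : B' ⊆ B := by
  obtain ⟨_, _, _, _, rfl⟩ := h
  exact fun _ h => h.1

lemma subset_of_reflTransGen (h : Relation.ReflTransGen (Postbar k) B B') : B' ⊆ B := by
  induction h with
  | refl => exact subset_rfl
  | tail _ h ih => exact h.subset.trans ih

variable [NeZero k]

lemma expo_le_expo {e e' : Fin d →₀ ℕ} : expo k e ≤ expo k e' ↔ e ≤ e' := by
  have hk : (0 : ℚ) < k := by exact_mod_cast Nat.pos_of_ne_zero (NeZero.ne k)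
  refine forall_congr' fun i => ?_
  simp only [expo]
  rw [div_le_div_iff_of_pos_right hk]
  exact Nat.cast_le

lemma expo_injective : Function.Injective (expo k : (Fin d →₀ ℕ) → Fin d → ℚ) :=
  fun _ _ h => le_antisymm (expo_le_expo.1 h.le) (expo_le_expo.1 h.ge)

lemma HasHeight.expo_inj {e e' : Fin d →₀ ℕ}
    (h : HasHeight k B (expo k e : Fin d → ℚ)) (h' : HasHeight k B (expo k e' : Fin d → ℚ)) :
    e = e' :=
  expo_injective (WithTop.coe_injective (h.unique h'))

/-- By minimality of the height, `Y - Z` is zero or has leading exponent at least `e`; the exponent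
is `e` itself exactly when the coefficient there is nonzero. -/
lemma congrMod_iff (hB : HasContacts k B) {e : Fin d →₀ ℕ}
    (he : HasHeight k B (expo k e : Fin d → ℚ)) {Y Z : MvPowerSeries (Fin d) K}
    (hY : Y ∈ B) (hZ : Z ∈ B) : CongrMod k (expo k e) Y Z ↔ coeff e Z = coeff e Y := by
  constructor
  · rintro ⟨o, ⟨rfl, -⟩ | ⟨e', u, hu, h, rfl⟩, hlt⟩
    · rfl
    · by_contra hne
      have hle := IsMonomialMulUnit.le_of_coeff_ne_zero ⟨u, hu, h⟩ (m := e)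
        (by rw [map_sub, sub_ne_zero]; exact Ne.symm hne)
      exact (WithTop.coe_lt_coe.1 hlt).not_ge (expo_le_expo.2 hle)
  · intro h
    obtain ⟨o, ho⟩ := hB Y hY Z hZ
    refine ⟨o, ho, lt_of_le_of_ne (he.2 ⟨Y, hY, Z, hZ, ho⟩) ?_⟩
    rintro rfl
    obtain ⟨-, ho⟩ | ⟨e', u, hu, h', ho⟩ := ho
    · exact WithTop.coe_ne_top ho
    · obtain rfl := expo_injective (WithTop.coe_injective ho)
      refine IsMonomialMulUnit.coeff_ne_zero ⟨u, hu, h'⟩ ?_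
      rw [map_sub, h, sub_self]

lemma Postbar.exists_expo (hB : HasContacts k B) (h : Postbar k B B') :
    ∃ e : Fin d →₀ ℕ, HasHeight k B (expo k e : Fin d → ℚ) ∧
      ∃ Y ∈ B, B' = {Z | Z ∈ B ∧ coeff e Z = coeff e Y} := by
  obtain ⟨h, hh, Y, hY, rfl⟩ := h
  obtain ⟨e, rfl, -⟩ := hh.exists_expo
  refine ⟨e, hh, Y, hY, Set.ext fun Z => and_congr_right fun hZ => congrMod_iff hB hh hY hZ⟩

lemma Postbar.nonempty (hB : HasContacts k B) (h : Postbar k B B') : B'.Nonempty := by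
  obtain ⟨e, -, Y, hY, rfl⟩ := h.exists_expo hB
  exact ⟨Y, hY, rfl⟩

lemma Postbar.not_subset (hB : HasContacts k B) (h : Postbar k B B') : ¬ B ⊆ B' := by
  obtain ⟨e, he, Y, hY, rfl⟩ := h.exists_expo hB
  obtain ⟨e', hee, Z, hZ, W, hW, hZW⟩ := he.exists_expo
  obtain rfl := expo_injective hee
  exact fun hs => hZW ((hs hZ).2.trans (hs hW).2.symm)

lemma Postbar.eq_of_mem (hB : HasContacts k B) {B₁ B₂ : Set (MvPowerSeries (Fin d) K)}
    (h₁ : Postbar k B B₁) (h₂ : Postbar k B B₂) {Y : MvPowerSeries (Fin d) K} (hY₁ : Y ∈ B₁)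
    (hY₂ : Y ∈ B₂) : B₁ = B₂ := by
  obtain ⟨e, he, Y₁, -, rfl⟩ := h₁.exists_expo hB
  obtain ⟨e', he', Y₂, -, rfl⟩ := h₂.exists_expo hB
  obtain rfl := he.expo_inj he'
  rw [← hY₁.2, ← hY₂.2]

lemma Postbar.exists_postbarAt (hB : HasContacts k B) (h : Postbar k B B') :
    ∃ c, PostbarAt k B c B' := by
  have h' := h
  obtain ⟨e, he, Y, hY, rfl⟩ := h.exists_expo hB
  exact ⟨coeff e Y, h', e, he, fun Z hZ => hZ.2⟩

lemma PostbarAt.eq_setOf (hB : HasContacts k B) {c : K} (h : PostbarAt k B c B')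
    {e : Fin d →₀ ℕ} (he : HasHeight k B (expo k e : Fin d → ℚ)) :
    B' = {Z | Z ∈ B ∧ coeff e Z = c} := by
  obtain ⟨h, e₁, he₁, hc⟩ := h
  obtain rfl := he.expo_inj he₁
  obtain ⟨e', he', Y, hY, rfl⟩ := h.exists_expo hB
  obtain rfl := he.expo_inj he'
  rw [hc Y ⟨hY, rfl⟩]

lemma PostbarAt.coeff_unique (hB : HasContacts k B) {c c' : K} (h : PostbarAt k B c B')
    (h' : PostbarAt k B c' B') : c = c' := by
  obtain ⟨e, he, hc⟩ := h.2
  obtain ⟨e', he', hc'⟩ := h'.2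
  obtain rfl := he.expo_inj he'
  obtain ⟨Y, hY⟩ := h.1.nonempty hB
  exact (hc Y hY).symm.trans (hc' Y hY)

variable {f : Polynomial (MvPowerSeries (Fin d) K)}

lemma subset_zer_of_mem_bars (hB : B ∈ bars k f) : B ⊆ zer k f :=
  subset_of_reflTransGen hB.2

lemma bars_tail (hB : B ∈ bars k f) (h : Postbar k B B') : B' ∈ bars k f :=
  ⟨hB.1, hB.2.tail h⟩

/-- Distinct postbars of one bar are disjoint, so the paths to two bars that share a root cannot
branch apart. -/
lemma reflTransGen_or_of_mem (hf : HasContacts k (zer k f))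
    {A : Set (MvPowerSeries (Fin d) K)} (hA : A ∈ bars k f) (hB : B ∈ bars k f)
    {Y : MvPowerSeries (Fin d) K} (hYA : Y ∈ A) (hYB : Y ∈ B) :
    Relation.ReflTransGen (Postbar k) A B ∨ Relation.ReflTransGen (Postbar k) B A := by
  induction hB.2 with
  | refl => exact Or.inr hA.2
  | @tail B B' hr h ih =>
    have hB : B ∈ bars k f := ⟨hA.1, hr⟩
    rcases ih hB (h.subset hYB) with h' | h'
    · exact Or.inl (h'.tail h)
    · rcases h'.cases_head with rfl | ⟨C, hC, h''⟩
      · exact Or.inl (.single h)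
      · obtain rfl := hC.eq_of_mem (hf.mono (subset_zer_of_mem_bars hB)) h
          (subset_of_reflTransGen h'' hYA) hYB
        exact Or.inr h''

lemma Postbar.parent_unique (hf : HasContacts k (zer k f))
    {A : Set (MvPowerSeries (Fin d) K)} (hA : A ∈ bars k f) (hB : B ∈ bars k f)
    (h : Postbar k A B') (h' : Postbar k B B') : A = B := by
  have hAc := hf.mono (subset_zer_of_mem_bars hA)
  have hBc := hf.mono (subset_zer_of_mem_bars hB)
  obtain ⟨Y, hY⟩ := h.nonempty hAc
  rcases reflTransGen_or_of_mem hf hA hB (h.subset hY) (h'.subset hY) with hr | hr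
  · rcases hr.cases_head with rfl | ⟨C, hC, hr⟩
    · rfl
    · obtain rfl := hC.eq_of_mem hAc h (subset_of_reflTransGen hr (h'.subset hY)) hY
      exact absurd (subset_of_reflTransGen hr) (h'.not_subset hBc)
  · rcases hr.cases_head with rfl | ⟨C, hC, hr⟩
    · rfl
    · obtain rfl := hC.eq_of_mem hBc h' (subset_of_reflTransGen hr (h.subset hY)) hY
      exact absurd (subset_of_reflTransGen hr) (h.not_subset hAc)

lemma heightSet_zer (hf : HasContacts k (zer k f)) : heightSet k f (zer k f) = ∅ := by
  refine Set.eq_empty_of_forall_notMem ?_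
  rintro h ⟨A, hA, c, A', hAA', -, hr, -⟩
  have hs := subset_zer_of_mem_bars hA
  exact hAA'.1.not_subset (hf.mono hs) (hs.trans (subset_of_reflTransGen hr))

lemma heightSet_postbar (hf : HasContacts k (zer k f)) (hB : B ∈ bars k f) {c : K}
    (h : PostbarAt k B c B') :
    heightSet k f B' = heightSet k f B ∪ {o | c ≠ 0 ∧ HasHeight k B o} := by
  have hBc := hf.mono (subset_zer_of_mem_bars hB)
  ext o
  constructor
  · rintro ⟨A, hA, c', A', hAA', hc', hr, ho⟩
    rcases hr.cases_tail with rfl | ⟨C, hr, hC⟩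
    · obtain rfl := hAA'.1.parent_unique hf hA hB h.1
      obtain rfl := hAA'.coeff_unique hBc h
      exact Or.inr ⟨hc', ho⟩
    · have hCb : C ∈ bars k f := ⟨hA.1, (hA.2.tail hAA'.1).trans hr⟩
      obtain rfl := hC.parent_unique hf hCb hB h.1
      exact Or.inl ⟨A, hA, c', A', hAA', hc', hr, ho⟩
  · rintro (⟨A, hA, c', A', hAA', hc', hr, ho⟩ | ⟨hc, ho⟩)
    · exact ⟨A, hA, c', A', hAA', hc', hr.tail h.1, ho⟩
    · exact ⟨B, hB, c, B', h, hc, .refl, ho⟩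

end Bars

end QuasiOrdinary

namespace QuasiOrdinary

open MvPowerSeries

variable {K : Type*} [Field K] {d : ℕ} {k : ℕ}

/-! ### Duality between roots of unity and exponents modulo `k` -/

lemma rootsOfUnity_coe_pow (ζ : rootsOfUnity k K) : (ζ : Kˣ) ^ k = 1 :=
  (mem_rootsOfUnity k _).1 ζ.2

variable [NeZero k]

/-- The pairing of `U^d` with `(ℤ/k)^d`, that sends `(ε, v)` to `∏ i, εᵢ ^ vᵢ`. -/
noncomputable def rootPairing :
    (Fin d → rootsOfUnity k K) →* (Multiplicative (Fin d → ZMod k) →* Kˣ) where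
  toFun ε :=
    { toFun := fun v => ∏ i, AddChar.zmodChar k (rootsOfUnity_coe_pow (ε i)) (v.toAdd i)
      map_one' := by simp
      map_mul' := fun v w => by simp [AddChar.map_add_eq_mul, Finset.prod_mul_distrib] }
  map_one' := by
    ext v
    simp [AddChar.zmodChar_apply]
  map_mul' ε ε' := by
    ext v
    simp [AddChar.zmodChar_apply, mul_pow, Finset.prod_mul_distrib]

/-- The exponent `e` modulo `k`. -/
def expoMod (k : ℕ) (e : Fin d →₀ ℕ) : Multiplicative (Fin d → ZMod k) :=
  .ofAdd fun i => (e i : ZMod k)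

lemma rootPairing_expoMod (ε : Fin d → rootsOfUnity k K) (e : Fin d →₀ ℕ) :
    rootPairing ε (expoMod k e) = ∏ i, (ε i : Kˣ) ^ e i := by
  simp [rootPairing, expoMod, AddChar.zmodChar_apply']

lemma coeff_starAct (ε : Fin d → rootsOfUnity k K) (Y : MvPowerSeries (Fin d) K)
    (e : Fin d →₀ ℕ) :
    coeff e (starAct k ε Y) = (rootPairing ε (expoMod k e) : Kˣ) * coeff e Y := by
  rw [starAct, coeff_rescale, rootPairing_expoMod, Finsupp.prod_fintype _ _ (by simp)]
  simp

/-- A character of `(ℤ/k)^d` is determined by its values on the standard basis, which are `k`-th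
roots of unity. -/
lemma rootPairing_surjective :
    Function.Surjective (rootPairing (K := K) (d := d) (k := k)) := by
  intro χ
  let b (i : Fin d) : Multiplicative (Fin d → ZMod k) := .ofAdd (Pi.single i 1)
  have hb (i : Fin d) : b i ^ k = 1 := by
    refine Multiplicative.toAdd.injective ?_
    simp only [b, toAdd_pow, toAdd_ofAdd, toAdd_one]
    ext j
    simp
  refine ⟨fun i => ⟨χ (b i), (mem_rootsOfUnity k _).2 (by rw [← map_pow, hb, map_one])⟩, ?_⟩
  refine MonoidHom.ext fun v => ?_
  have hv : v = ∏ i, b i ^ (v.toAdd i).val := by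
    refine Multiplicative.toAdd.injective ?_
    simp only [b, toAdd_prod, toAdd_pow, toAdd_ofAdd]
    ext j
    simp only [Finset.sum_apply, Pi.smul_apply, Pi.single_apply, smul_ite, smul_zero,
      Finset.sum_ite_eq, Finset.mem_univ, if_true, nsmul_one, ZMod.natCast_val, ZMod.cast_id]
  conv_rhs => rw [hv]
  simp [rootPairing, AddChar.zmodChar_apply]

/-- `K` has enough roots of unity, so every character of `H` extends to `(ℤ/k)^d` and `H` has as
many characters as elements. -/
lemma index_annihilator [IsAlgClosed K] [CharZero K]
    (H : Subgroup (Multiplicative (Fin d → ZMod k))) :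
    (((MonoidHom.domRestrictHom H Kˣ).comp
      (rootPairing : (Fin d → rootsOfUnity k K) →* _)).ker).index = Nat.card H := by
  have hexp : Monoid.exponent (Multiplicative (Fin d → ZMod k)) ∣ k := by
    refine Monoid.exponent_dvd_of_forall_pow_eq_one fun v => ?_
    refine Multiplicative.toAdd.injective ?_
    ext i
    simp
  have : HasEnoughRootsOfUnity K (Monoid.exponent (Multiplicative (Fin d → ZMod k))) :=
    HasEnoughRootsOfUnity.of_dvd K hexp
  have : HasEnoughRootsOfUnity K (Monoid.exponent H) :=
    HasEnoughRootsOfUnity.of_dvd K ((Monoid.exponent_submonoid_dvd H.toSubmonoid).trans hexp)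
  have hsurj : Function.Surjective ((MonoidHom.domRestrictHom H Kˣ).comp
      (rootPairing : (Fin d → rootsOfUnity k K) →* _)) := by
    rw [MonoidHom.coe_comp]
    exact (MonoidHom.domRestrict_surjective K H).comp rootPairing_surjective
  rw [Subgroup.index_ker, MonoidHom.range_eq_top.2 hsurj, Subgroup.card_top, CommGroup.card_monoidHom_of_hasEnoughRootsOfUnity]

/-! ### Lattices between `ℤ^d` and `(1/k)ℤ^d` -/

/-- After scaling by `k`, `ℤ^d` becomes the kernel of reduction modulo `k`, so the index is the
order of the image in `(ℤ/k)^d`. -/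
lemma intLattice_relIndex_sup_closure {H : Set (Fin d → ℚ)}
    (hH : H ⊆ Set.range (expo k : (Fin d →₀ ℕ) → Fin d → ℚ)) :
    (intLattice d).relIndex (intLattice d ⊔ AddSubgroup.closure H) =
      Nat.card (Subgroup.closure (expoMod k '' {e : Fin d →₀ ℕ | expo k e ∈ H})) := by
  have hk : (k : ℚ) ≠ 0 := by exact_mod_cast NeZero.ne k
  let s : (Fin d → ℤ) →+ (Fin d → ℚ) :=
    { toFun := fun e i => (e i : ℚ) / k
      map_zero' := by ext; simp
      map_add' := fun e e' => by ext; simp [add_div] }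
  let ψ : (Fin d → ℤ) →+ (Fin d → ZMod k) := (Int.castAddHom (ZMod k)).compLeft (Fin d)
  let toInt (e : Fin d →₀ ℕ) : Fin d → ℤ := fun i => e i
  let S := {e : Fin d →₀ ℕ | expo k e ∈ H}
  have hs : Function.Injective s := by
    intro e e' h
    ext i
    have := congrFun h i
    simpa [s, div_left_inj' hk] using this
  have hker : intLattice d = ψ.ker.map s := by
    ext x
    constructor
    · rintro ⟨e, rfl⟩
      refine ⟨(k : ℤ) • e, ?_, ?_⟩
      · ext i; simp [ψ]
      · ext i; simp [s]; field_simp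
    · rintro ⟨e, he, rfl⟩
      have (i : Fin d) : ∃ m : ℤ, e i = k * m :=
        (ZMod.intCast_zmod_eq_zero_iff_dvd _ k).1 (congrFun he i)
      choose m hm using this
      refine ⟨m, ?_⟩
      ext i
      simp [s, hm]; field_simp
  have himg : s '' (toInt '' S) = H := by
    rw [← Set.image_comp]
    ext x
    constructor
    · rintro ⟨e, he, rfl⟩
      exact he
    · intro hx
      obtain ⟨e, rfl⟩ := hH hx
      exact ⟨e, hx, rfl⟩
  have hcl : AddSubgroup.closure H = (AddSubgroup.closure (toInt '' S)).map s := by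
    rw [AddMonoidHom.map_closure, himg]
  rw [hcl, hker, ← AddSubgroup.map_sup, AddSubgroup.relIndex_map_map_of_injective _ _ hs,
    AddSubgroup.relIndex_ker, AddSubgroup.map_sup,
    (AddSubgroup.map_eq_bot_iff _).2 le_rfl, bot_sup_eq, AddMonoidHom.map_closure,
    ← Set.image_comp]
  have hmod : (ψ ∘ toInt) '' S = Multiplicative.ofAdd ⁻¹' (expoMod k '' S) := by
    ext v
    constructor
    · rintro ⟨e, he, rfl⟩
      exact ⟨e, he, by ext; simp [expoMod, ψ, toInt]⟩
    · rintro ⟨e, he, h⟩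
      refine ⟨e, he, Multiplicative.ofAdd.injective (h ▸ ?_)⟩
      ext; simp [expoMod, ψ, toInt]
  rw [hmod]
  refine Nat.card_congr (Equiv.subtypeEquiv Multiplicative.ofAdd fun v => ?_)
  rw [← Subgroup.mem_toAddSubgroup', Subgroup.toAddSubgroup'_closure]

end QuasiOrdinary

namespace QuasiOrdinary

open MvPowerSeries

open scoped Pointwise

variable {K : Type*} [Field K] {d : ℕ} {k : ℕ}

/-! ### The action of `U^d` on the tree model -/

noncomputable instance starMulAction :
    MulAction (Fin d → rootsOfUnity k K) (MvPowerSeries (Fin d) K) where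
  smul := starAct k
  one_smul Y := by
    change starAct k 1 Y = Y
    simp [starAct, ← Pi.one_def]
  mul_smul ε ε' Y := by
    change starAct k (ε * ε') Y = starAct k ε (starAct k ε' Y)
    rw [starAct, starAct, starAct, rescale_rescale]
    congr 2
    ext i
    simp [mul_comm]

lemma smul_eq_starAct (ε : Fin d → rootsOfUnity k K) (Y : MvPowerSeries (Fin d) K) :
    ε • Y = starAct k ε Y := rfl

lemma HasContact.smul (ε : Fin d → rootsOfUnity k K) {Y Z : MvPowerSeries (Fin d) K}
    {o : WithTop (Fin d → ℚ)} (h : HasContact k Y Z o) : HasContact k (ε • Y) (ε • Z) o := by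
  obtain ⟨rfl, rfl⟩ | ⟨e, u, hu, he, rfl⟩ := h
  · exact Or.inl ⟨rfl, rfl⟩
  -- The scalar by which `ε` acts on `T^e`; it is absorbed into the unit.
  · let a : Kˣ := ∏ i, (ε i : Kˣ) ^ e i
    refine Or.inr ⟨e, C (a : K) * starAct k ε u, ?_, ?_, rfl⟩
    · rw [map_mul, constantCoeff_C, ← coeff_zero_eq_constantCoeff_apply, starAct, coeff_rescale]
      simpa using hu
    · rw [smul_eq_starAct, smul_eq_starAct, starAct, starAct, ← map_sub, he, map_mul, ← mul_assoc]
      congr 1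
      classical
      ext n
      rw [coeff_rescale, coeff_mul_C, coeff_monomial]
      split_ifs with h
      · subst h
        rw [Finsupp.prod_fintype _ _ (by simp)]
        simp [a]
      · simp

lemma hasContact_smul_iff (ε : Fin d → rootsOfUnity k K) {Y Z : MvPowerSeries (Fin d) K}
    {o : WithTop (Fin d → ℚ)} : HasContact k (ε • Y) (ε • Z) o ↔ HasContact k Y Z o :=
  ⟨fun h => by simpa using h.smul ε⁻¹, fun h => h.smul ε⟩

lemma HasHeight.smul (ε : Fin d → rootsOfUnity k K) {B : Set (MvPowerSeries (Fin d) K)}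
    {o : WithTop (Fin d → ℚ)} (h : HasHeight k B o) : HasHeight k (ε • B) o := by
  rw [HasHeight] at h ⊢
  convert h using 1
  ext o'
  simp only [Set.mem_ofPred_eq, ← Set.image_smul, Set.exists_mem_image, hasContact_smul_iff]

lemma Postbar.smul (ε : Fin d → rootsOfUnity k K) {B B' : Set (MvPowerSeries (Fin d) K)}
    (h : Postbar k B B') : Postbar k (ε • B) (ε • B') := by
  obtain ⟨h, hh, Y, hY, rfl⟩ := h
  refine ⟨h, hh.smul ε, ε • Y, Set.smul_mem_smul_set hY, ?_⟩
  ext Z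
  have : CongrMod k h (ε • Y) Z ↔ CongrMod k h Y (ε⁻¹ • Z) :=
    exists_congr fun o => and_congr_left fun _ => by
      rw [← hasContact_smul_iff ε (Y := Y), smul_inv_smul]
  simp only [Set.mem_smul_set_iff_inv_smul_mem, Set.mem_ofPred_eq, this]

variable [NeZero k] {f : Polynomial (MvPowerSeries (Fin d) K)}

lemma coeff_smul_eq (ε : Fin d → rootsOfUnity k K) (Y : MvPowerSeries (Fin d) K)
    (e : Fin d →₀ ℕ) :
    coeff e (ε • Y) = (rootPairing ε (expoMod k e) : Kˣ) * coeff e Y :=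
  coeff_starAct ε Y e

/-- The coefficients of `f` involve only `k`-th powers of the `Tᵢ`, so the action fixes them and
permutes the roots. -/
lemma starAct_expand (ε : Fin d → rootsOfUnity k K) (g : MvPowerSeries (Fin d) K) :
    starAct k ε (expand k (NeZero.ne k) g) = expand k (NeZero.ne k) g := by
  ext e
  rw [starAct, coeff_rescale]
  by_cases h : ∀ i, k ∣ e i
  · rw [Finsupp.prod, Finset.prod_eq_one, one_mul]
    intro i _
    obtain ⟨m, hm⟩ := h i
    rw [hm]
    rw [pow_mul, ← Units.val_pow_eq_pow_val, rootsOfUnity_coe_pow, Units.val_one, one_pow]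
  · push Not at h
    obtain ⟨i, hi⟩ := h
    rw [coeff_expand_of_not_dvd _ _ _ hi, mul_zero]

lemma smul_mem_zer (ε : Fin d → rootsOfUnity k K) {Y : MvPowerSeries (Fin d) K}
    (hY : Y ∈ zer k f) : ε • Y ∈ zer k f := by
  have h := Polynomial.hom_eval₂ f (expand k (NeZero.ne k)).toRingHom
    (rescale fun i => ((ε i : Kˣ) : K)) Y
  rw [show f.eval₂ (expand k (NeZero.ne k)).toRingHom Y = 0 from hY, map_zero] at h
  rw [zer, Set.mem_ofPred_eq, smul_eq_starAct, starAct, h]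
  congr 1
  ext1 g
  exact (starAct_expand ε g).symm

lemma smul_zer (ε : Fin d → rootsOfUnity k K) : ε • zer k f = zer k f := by
  refine Set.Subset.antisymm ?_ fun Y hY => ?_
  · rintro _ ⟨Y, hY, rfl⟩
    exact smul_mem_zer ε hY
  · exact Set.mem_smul_set_iff_inv_smul_mem.2 (smul_mem_zer ε⁻¹ hY)

/-! ### Stabilizers of bars -/

variable {B B' : Set (MvPowerSeries (Fin d) K)}

/-- A conjugate of a bar that meets the bar is the bar. -/
lemma smul_eq_self_of_mem (hf : HasContacts k (zer k f)) (hB : B ∈ bars k f)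
    (ε : Fin d → rootsOfUnity k K) {Y : MvPowerSeries (Fin d) K} (hY : Y ∈ B)
    (hY' : Y ∈ ε • B) : ε • B = B := by
  induction hB.2 with
  | refl => exact smul_zer ε
  | @tail B B' hr h ih =>
    have hB : B ∈ bars k f := ⟨hB.1, hr⟩
    have hεB := ih hB (h.subset hY) (Set.smul_set_mono h.subset hY')
    have h' := h.smul ε
    rw [hεB] at h'
    exact h'.eq_of_mem (hf.mono (subset_zer_of_mem_bars hB)) h hY' hY

lemma stabilizer_le_of_postbar (hf : HasContacts k (zer k f)) (hB : B ∈ bars k f)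
    (h : Postbar k B B') :
    MulAction.stabilizer (Fin d → rootsOfUnity k K) B' ≤ MulAction.stabilizer _ B := by
  intro ε hε
  rw [MulAction.mem_stabilizer_iff] at hε ⊢
  obtain ⟨Y, hY⟩ := h.nonempty (hf.mono (subset_zer_of_mem_bars hB))
  exact smul_eq_self_of_mem hf hB ε (h.subset hY)
    (Set.smul_set_mono h.subset (hε.symm ▸ hY))

/-- A bar equals any conjugate it meets, so one root `Y` of `B'` decides whether `ε` fixes `B'`. -/
lemma mem_stabilizer_postbar_iff (hf : HasContacts k (zer k f)) (hB : B ∈ bars k f) {c : K}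
    (h : PostbarAt k B c B') {e : Fin d →₀ ℕ}
    (he : HasHeight k B (expo k e : Fin d → ℚ)) (ε : Fin d → rootsOfUnity k K) :
    ε ∈ MulAction.stabilizer _ B' ↔
      ε ∈ MulAction.stabilizer _ B ∧ (c ≠ 0 → rootPairing ε (expoMod k e) = 1) := by
  have hBc := hf.mono (subset_zer_of_mem_bars hB)
  obtain ⟨Y, hY⟩ := h.1.nonempty hBc
  have hB' := h.eq_setOf hBc he
  have hcoeff : coeff e (ε • Y) = coeff e Y ↔ (c ≠ 0 → rootPairing ε (expoMod k e) = 1) := by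
    have hc : coeff e Y = c := (hB' ▸ hY).2
    rw [coeff_smul_eq, hc]
    by_cases h0 : c = 0
    · simp [h0]
    · simp [h0]
  rw [← hcoeff]
  constructor
  · intro hε
    refine ⟨stabilizer_le_of_postbar hf hB h.1 hε, ?_⟩
    have hεY : ε • Y ∈ B' := by
      rw [← MulAction.mem_stabilizer_iff.1 hε]
      exact Set.smul_mem_smul_set hY
    rw [hB'] at hY hεY
    rw [hεY.2, hY.2]
  · rintro ⟨hε, hY'⟩
    rw [MulAction.mem_stabilizer_iff] at hε ⊢
    refine smul_eq_self_of_mem hf (bars_tail hB h.1) ε (Y := ε • Y) ?_ (Set.smul_mem_smul_set hY)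
    have h1 : ε • Y ∈ ε • B := Set.smul_mem_smul_set (h.1.subset hY)
    rw [hε] at h1
    rw [hB'] at hY ⊢
    exact ⟨h1, hY'.trans hY.2⟩

lemma heightSet_subset_range_expo :
    heightSet k f B ⊆ Set.range (expo k : (Fin d →₀ ℕ) → Fin d → ℚ) := by
  rintro h ⟨A, hA, c, A', hAA', hc, -, hh⟩
  obtain ⟨e, rfl, -⟩ := hh.exists_expo
  exact ⟨e, rfl⟩

lemma mem_stabilizer_iff_of_mem_bars (hf : HasContacts k (zer k f)) (hB : B ∈ bars k f)
    (ε : Fin d → rootsOfUnity k K) :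
    ε ∈ MulAction.stabilizer _ B ↔
      ∀ e : Fin d →₀ ℕ, expo k e ∈ heightSet k f B → rootPairing ε (expoMod k e) = 1 := by
  induction hB.2 with
  | refl => simp [heightSet_zer hf, smul_zer]
  | @tail B B' hr h ih =>
    have hB : B ∈ bars k f := ⟨hB.1, hr⟩
    obtain ⟨c, hc⟩ := h.exists_postbarAt (hf.mono (subset_zer_of_mem_bars hB))
    obtain ⟨e, he, -⟩ := hc.2
    rw [mem_stabilizer_postbar_iff hf hB hc he, heightSet_postbar hf hB hc, ih hB]
    simp only [Set.mem_union, or_imp, forall_and, Set.mem_ofPred_eq, and_imp]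
    refine and_congr_right fun _ => ⟨fun h e' h0 he' => ?_, fun h h0 => h e h0 he⟩
    obtain rfl := he.expo_inj he'
    exact h h0

lemma index_stabilizer_eq [IsAlgClosed K] [CharZero K] (hf : HasContacts k (zer k f))
    (hB : B ∈ bars k f) :
    (MulAction.stabilizer (Fin d → rootsOfUnity k K) B).index =
      (intLattice d).relIndex (charLattice k f B) := by
  rw [charLattice, intLattice_relIndex_sup_closure heightSet_subset_range_expo,
    ← index_annihilator (K := K)]
  congr 1
  ext ε
  rw [mem_stabilizer_iff_of_mem_bars hf hB, MonoidHom.mem_ker]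
  have : (MonoidHom.domRestrictHom (Subgroup.closure
      (expoMod k '' {e : Fin d →₀ ℕ | expo k e ∈ heightSet k f B})) Kˣ).comp rootPairing ε = 1 ↔
      Subgroup.closure (expoMod k '' {e : Fin d →₀ ℕ | expo k e ∈ heightSet k f B}) ≤
        (rootPairing ε).ker := by
    simp [DFunLike.ext_iff, SetLike.le_def, MonoidHom.mem_ker]
  rw [this, Subgroup.closure_le]
  simp [Set.subset_def]

lemma charLattice_postbar (hf : HasContacts k (zer k f)) (hB : B ∈ bars k f) {c : K}
    (h : PostbarAt k B c B') (hc : c ≠ 0) {o : Fin d → ℚ} (ho : HasHeight k B o) :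
    charLattice k f B' = charLattice k f B ⊔ AddSubgroup.zmultiples o := by
  have : {o' : Fin d → ℚ | c ≠ 0 ∧ HasHeight k B o'} = {o} := by
    ext o'
    exact ⟨fun h => WithTop.coe_injective (h.2.unique ho), fun h => ⟨hc, by rwa [h]⟩⟩
  rw [charLattice, heightSet_postbar hf hB h, this, AddSubgroup.closure_union, charLattice,
    sup_assoc, AddSubgroup.zmultiples_eq_closure]

/-- If `ε * B'` lies in `B`, then `ε * B` meets `B`, so `ε` stabilizes `B`. -/
lemma setOf_postbar_conjugates_eq (hf : HasContacts k (zer k f)) (hB : B ∈ bars k f)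
    (h : Postbar k B B') :
    {B'' | Postbar k B B'' ∧ B'' ∈ conjugates k B'} =
      MulAction.orbit (MulAction.stabilizer (Fin d → rootsOfUnity k K) B) B' := by
  ext B''
  constructor
  · rintro ⟨h'', ε, rfl⟩
    obtain ⟨Y, hY⟩ := h''.nonempty (hf.mono (subset_zer_of_mem_bars hB))
    exact ⟨⟨ε, smul_eq_self_of_mem hf hB ε (h''.subset hY) (Set.smul_set_mono h.subset hY)⟩, rfl⟩
  · rintro ⟨⟨ε, hε⟩, rfl⟩
    have h' := h.smul ε
    rw [MulAction.mem_stabilizer_iff.1 hε] at h'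
    exact ⟨h', ε, rfl⟩

lemma ncard_postbar_conjugates (hf : HasContacts k (zer k f)) (hB : B ∈ bars k f)
    (h : Postbar k B B') :
    {B'' | Postbar k B B'' ∧ B'' ∈ conjugates k B'}.ncard =
      (MulAction.stabilizer (Fin d → rootsOfUnity k K) B').relIndex
        (MulAction.stabilizer _ B) := by
  rw [setOf_postbar_conjugates_eq hf hB h, ← MulAction.index_stabilizer]
  rfl

end QuasiOrdinary

theorem theorem3 {K : Type*} [Field K] [IsAlgClosed K] [CharZero K] {d : ℕ}
    (f : Polynomial (MvPowerSeries (Fin d) K))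
    (hW : QuasiOrdinary.IsWeierstrass f) (hQ : QuasiOrdinary.IsQuasiOrdinary f)
    (k : ℕ) [NeZero k]
    (B : Set (MvPowerSeries (Fin d) K)) (hB : B ∈ QuasiOrdinary.bars k f) :
    (QuasiOrdinary.conjugates k B).ncard =
        (QuasiOrdinary.intLattice d).relIndex (QuasiOrdinary.charLattice k f B) ∧
      ∀ (c : K) (B' : Set (MvPowerSeries (Fin d) K)), QuasiOrdinary.PostbarAt k B c B' →
        (c ≠ 0 → ∀ h : Fin d → ℚ, QuasiOrdinary.HasHeight k B h →
          {B'' | QuasiOrdinary.Postbar k B B'' ∧ B'' ∈ QuasiOrdinary.conjugates k B'}.ncard =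
            (QuasiOrdinary.charLattice k f B).relIndex
              (QuasiOrdinary.charLattice k f B ⊔ AddSubgroup.zmultiples h)) ∧
        (c = 0 →
          {B'' | QuasiOrdinary.Postbar k B B'' ∧ B'' ∈ QuasiOrdinary.conjugates k B'} = {B'}) := by
  open QuasiOrdinary Pointwise in
  have hf : HasContacts k (zer k f) := fun Y hY Z hZ => exists_hasContact k hW.1 hQ hY hZ
  refine ⟨?_, fun c B' h => ⟨fun hc o ho => ?_, ?_⟩⟩
  · exact (MulAction.index_stabilizer (Fin d → rootsOfUnity k K) B).symm.trans
      (index_stabilizer_eq hf hB)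
  · rw [ncard_postbar_conjugates hf hB h.1]
    -- Both indices are multiplicative in towers; cancel the common factor `[N(B) : ℤ^d]`, nonzero
    -- because `U^d` is finite.
    have hG := Subgroup.relIndex_mul_index (stabilizer_le_of_postbar hf hB h.1)
    have hlat := (intLattice d).relIndex_mul_relIndex (charLattice k f B)
      (charLattice k f B ⊔ AddSubgroup.zmultiples o) le_sup_left le_sup_left
    rw [index_stabilizer_eq hf hB, index_stabilizer_eq hf (bars_tail hB h.1),
      charLattice_postbar hf hB h hc ho, ← hlat, mul_comm] at hG
    refine Nat.eq_of_mul_eq_mul_left (Nat.pos_of_ne_zero ?_) hG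
    rw [← index_stabilizer_eq hf hB]
    exact Subgroup.index_ne_zero_of_finite
  · rintro rfl
    rw [setOf_postbar_conjugates_eq hf hB h.1]
    ext B''
    constructor
    · rintro ⟨⟨ε, hε⟩, rfl⟩
      -- For `c = 0` the character condition is void, so the stabilizer of `B` fixes `B'`.
      obtain ⟨e, he, -⟩ := h.2
      exact ((mem_stabilizer_postbar_iff hf hB h he ε).2 ⟨hε, by simp⟩ :)
    · rintro rfl
      exact ⟨1, one_smul _ _⟩
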